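/- Let $X$ be a non-empty Tychonoff (completely regular Hausdorff) space, and let $C_k(X)$ be the set of continuous functions $X\to\mathbb R$ with the compact-open topology, with $\mathbf 0$ the zero function. Notation. For families of sets $\mathcal A,\mathcal B$, the game $G_1(\mathcal A,\mathcal B)$ has rounds $n=0,1,2,\dots$; in round $n$ player One plays $A_n\in\mathcal A$ and player Two answers with $B_n\in A_n$. Two wins the run if $\{B_n:n\in\omega\}\in\mathcal B$; otherwise One wins. $G_1(\mathcal A,\neg\mathcal B)$ is the same game, except that Two wins if $\{B_n:n\in\omega\}\notin\mathcal B$. A strategy must only make legal moves. A predetermined strategy for One depends only on the round number; a Markov strategy for Two depends only on One's current move and the round number. $\mathrm I\uparrow$, $\mathrm I\uparrow_{\mathrm{pre}}$, $\mathrm{II}\uparrow$, $\mathrm{II}\uparrow_{\mathrm{mark}}$ mean that the player has a winning strategy, respectively a winning predetermined or Markov strategy. $S_1(\mathcal A,\mathcal B)$ says that for all $A_n\in\mathcal A$ $(n\in\omega)$ there are $B_n\in A_n$ with $\{B_n:n\in\omega\}\in\mathcal B$. A $k$-cover of $X$ is a family $\mathscr U$ of open sets with $\bigcup\mathscr U=X$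 and $X\notin\mathscr U$ such that each compact $K\subseteq X$ is contained in some $U\in\mathscr U$; $\mathcal K_X$ is the set of all $k$-covers. $\mathscr N[K(X)]$ is the set of all $\mathscr N(K)=\{U\subsetneq X: U\text{ open},\ K\subseteq U\}$, for $K\subseteq X$ non-empty and compact (so One picks $K$ and Two picks an open $U\supseteq K$, $U\neq X$, the whole space being no member of a cover). For a space $Y$ and $y\in Y$: $\mathscr N_y$ is the set of open neighbourhoods of $y$; $\mathscr T_Y$ the set of non-empty open subsets; $\Omega_{Y,y}$ the set of all $A\subseteq Y$ with $y\in\overline A$; $\mathcal D_Y$ the set of dense subsets; $CD_Y$ the set of closed discrete subsets. $Y$ has strong countable fan tightness (sCFT) if $S_1(\Omega_{Y,y},\Omega_{Y,y})$ holds for all $y\in Y$, and strong countable dense fan tightness (sCDFT) if $S_1(\mathcal D_Y,\Omega_{Y,y})$ holds for all $y\in Y$. Theorem. The following are equivalent: (a) $\mathrm{II}\uparrow G_1(\mathscr N[K(X)],\neg\mathcal K_X)$ (a variation of the compact-open game); (b) $\mathrm{II}\uparrow_{\mathrm{mark}} G_1(\mathscr N[K(X)],\neg\mathcal K_X)$;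 (c) $\mathrm I\uparrow G_1(\mathcal K_X,\mathcal K_X)$ (a variation of the Rothberger game); (d) $S_1(\mathcal K_X,\mathcal K_X)$ fails; equivalently, $\mathrm I\uparrow_{\mathrm{pre}}G_1(\mathcal K_X,\mathcal K_X)$; (e) $\mathrm I\uparrow G_1(\Omega_{C_k(X),\mathbf 0},\Omega_{C_k(X),\mathbf 0})$ (the countable fan tightness game); (f) $C_k(X)$ is not sCFT; equivalently, $\mathrm I\uparrow_{\mathrm{pre}}G_1(\Omega_{C_k(X),\mathbf 0},\Omega_{C_k(X),\mathbf 0})$; (g) $\mathrm I\uparrow G_1(\mathcal D_{C_k(X)},\Omega_{C_k(X),\mathbf 0})$ (the countable dense fan tightness game); (h) $C_k(X)$ is not sCDFT; equivalently, $\mathrm I\uparrow_{\mathrm{pre}}G_1(\mathcal D_{C_k(X)},\Omega_{C_k(X),\mathbf 0})$; (i) $\mathrm{II}\uparrow G_1(\mathscr N_{\mathbf 0},\neg\Omega_{C_k(X),\mathbf 0})$ (Gruenhage's clustering game); (j) $\mathrm{II}\uparrow_{\mathrm{mark}}G_1(\mathscr N_{\mathbf 0},\neg\Omega_{C_k(X),\mathbf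 0})$; (k) $\mathrm{II}\uparrow G_1(\mathscr T_{C_k(X)},\neg\Omega_{C_k(X),\mathbf 0})$ (the closure game); (l) $\mathrm{II}\uparrow_{\mathrm{mark}}G_1(\mathscr T_{C_k(X)},\neg\Omega_{C_k(X),\mathbf 0})$; (m) $\mathrm{II}\uparrow G_1(\mathscr T_{C_k(X)},CD_{C_k(X)})$ (the closed discrete selection game); (n) $\mathrm{II}\uparrow_{\mathrm{mark}}G_1(\mathscr T_{C_k(X)},CD_{C_k(X)})$. -/

import Mathlib

open Set

namespace SelectionGame

universe u

/-! ### Single selection games and selection principles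

In `G₁(𝒜, ℬ)`, in round `n` One plays a set `Aₙ ∈ 𝒜` and Two answers with a point `Bₙ ∈ Aₙ`;
Two wins the run when `{Bₙ : n ∈ ω} ∈ ℬ`, and One wins otherwise. A strategy has to be legal:
a player who has no legal move at some position has no winning strategy through that position. -/

section Games

variable {α : Type u}

/-- The first `n` rounds `(A₀, B₀), …, (Aₙ₋₁, Bₙ₋₁)` of a run. -/
def history {β : Type u} (a : ℕ → β) (b : ℕ → α) (n : ℕ) : List (β × α) :=
  (List.range n).map fun i => (a i, b i)

/-- `I ↑ G₁(𝒜, ℬ)`: One has a winning strategy of perfect information. -/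
def OneWins (𝒜 ℬ : Set (Set α)) : Prop :=
  ∃ σ : List (𝒜 × α) → 𝒜, ∀ (a : ℕ → 𝒜) (b : ℕ → α),
    (∀ n, a n = σ (history a b n)) → (∀ n, b n ∈ (a n : Set α)) → range b ∉ ℬ

/-- One has a winning predetermined strategy in `G₁(𝒜, ℬ)`: it only sees the round number. -/
def OneWinsPre (𝒜 ℬ : Set (Set α)) : Prop :=
  ∃ σ : ℕ → 𝒜, ∀ b : ℕ → α, (∀ n, b n ∈ (σ n : Set α)) → range b ∉ ℬ

/-- `II ↑ G₁(𝒜, ℬ)`: Two has a winning strategy of perfect information. It sees the previous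
rounds and the current move of One. -/
def TwoWins (𝒜 ℬ : Set (Set α)) : Prop :=
  ∃ τ : List (𝒜 × α) → 𝒜 → α, ∀ (a : ℕ → 𝒜) (b : ℕ → α),
    (∀ n, b n = τ (history a b n) (a n)) → (∀ n, b n ∈ (a n : Set α)) ∧ range b ∈ ℬ

/-- Two has a winning Markov strategy in `G₁(𝒜, ℬ)`: it only sees the current move of One and the
round number. -/
def TwoWinsMarkov (𝒜 ℬ : Set (Set α)) : Prop :=
  ∃ τ : 𝒜 → ℕ → α, ∀ a : ℕ → 𝒜,
    (∀ n, τ (a n) n ∈ (a n : Set α)) ∧ range (fun n => τ (a n) n) ∈ ℬ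

/-- The single selection principle `S₁(𝒜, ℬ)`. -/
def S1 (𝒜 ℬ : Set (Set α)) : Prop :=
  ∀ A : ℕ → Set α, (∀ n, A n ∈ 𝒜) →
    ∃ b : ℕ → α, (∀ n, b n ∈ A n) ∧ range b ∈ ℬ

end Games

section Topology

/-- `K(X)`: the non-empty compact subsets of `X`. -/
def compacts (X : Type u) [TopologicalSpace X] : Set (Set X) :=
  {K | K.Nonempty ∧ IsCompact K}

/-- Open covers of `X`. Covers are non-trivial: `X` itself is not a member. -/
def openCovers (X : Type u) [TopologicalSpace X] : Set (Set (Set X)) :=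
  {𝒰 | (∀ U ∈ 𝒰, IsOpen U) ∧ ⋃₀ 𝒰 = univ ∧ univ ∉ 𝒰}

/-- `𝒦_X`: the `k`-covers of `X`. -/
def kCovers (X : Type u) [TopologicalSpace X] : Set (Set (Set X)) :=
  {𝒰 | 𝒰 ∈ openCovers X ∧ ∀ K : Set X, IsCompact K → ∃ U ∈ 𝒰, K ⊆ U}

/-- `𝒩(A)`: the open sets that contain `A` and can belong to a cover of `X`. As covers are
non-trivial, the whole space is left out. -/
def coveringNhds {X : Type u} [TopologicalSpace X] (A : Set X) : Set (Set X) :=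
  {U | IsOpen U ∧ A ⊆ U ∧ U ≠ univ}

/-- `𝒩[K(X)] = {𝒩(K) : K ∈ K(X)}`: One picks a non-empty compact `K`, and Two answers with an open
set that contains it. -/
def compactNhds (X : Type u) [TopologicalSpace X] : Set (Set (Set X)) :=
  coveringNhds '' compacts X

/-- `𝒩_y`: the open neighbourhoods of the point `y`. -/
def openNhds {Y : Type u} [TopologicalSpace Y] (y : Y) : Set (Set Y) :=
  {U | IsOpen U ∧ y ∈ U}

/-- `𝒯_Y`: the non-empty open subsets of `Y`. -/
def nonemptyOpens (Y : Type u) [TopologicalSpace Y] : Set (Set Y) :=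
  {U | IsOpen U ∧ U.Nonempty}

/-- `Ω_{Y,y}`: the sets that have `y` in their closure. -/
def blades {Y : Type u} [TopologicalSpace Y] (y : Y) : Set (Set Y) :=
  {A | y ∈ closure A}

/-- `𝒟_Y`: the dense subsets of `Y`. -/
def denseSets (Y : Type u) [TopologicalSpace Y] : Set (Set Y) :=
  {D | Dense D}

/-- `CD_Y`: the closed and discrete subsets of `Y`. -/
def closedDiscrete (Y : Type u) [TopologicalSpace Y] : Set (Set Y) :=
  {S | IsClosed S ∧ DiscreteTopology S}

/-- Strong countable fan tightness (at every point). -/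
def StrongCountableFanTight (Y : Type u) [TopologicalSpace Y] : Prop :=
  ∀ y : Y, S1 (blades y) (blades y)

/-- Strong countable dense fan tightness (at every point). -/
def StrongCountableDenseFanTight (Y : Type u) [TopologicalSpace Y] : Prop :=
  ∀ y : Y, S1 (denseSets Y) (blades y)

end Topology

end SelectionGame

/-!
The chain of implications has two substantial links; the others transfer strategies.

**From winning strategies of One to the failure of selection.** Let `Y` be the set of compact
subsets of `X`, with the topology that has the sets `{K | K ⊆ U}`, for open `U`, as a basis
(`CompactHyperspace`). A `k`-cover of `X` is an open cover of `Y` by basic sets, and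
`S₁(𝒦_X, 𝒦_X)` makes `Y` a Rothberger space (`S1.rothberger_compactHyperspace`). By Pawlikowski's
theorem, One has no winning strategy in the game of choosing from open covers of a Rothberger space
(`Rothberger.exists_play`), and in fact Two can cover every point infinitely often. This applies to
strategies in the `k`-cover game at once. It applies to strategies in the fan tightness game at `0`
by reading the choice of a function `f` in round `n` as the choice of the open set of those compact
sets on which `|f| < 1 / (n + 1)`: if every compact set is covered infinitely often, then `0` is in
the closure of the chosen functions.

Pawlikowski's theorem is proved for trees of countable covers. First, with increasing covers, a
form of Hurewicz's theorem gives a branch that covers every point infinitely often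
(`Rothberger.exists_branch`). It bounds finitely many nodes on each level of the original tree, such
that the corresponding finite families cover every point on infinitely many levels. One more
selection, from intersections taken over `k + 1` levels at a time, leaves a single child on each
level (`Rothberger.exists_branch_of_cover`).

**From the failure of selection to closed discrete selection.** Suppose that no selection from the
`k`-covers `𝒰ₙ` is a `k`-cover. If One plays a basic neighbourhood given by a function `f` and a
compact set `K`, then Two picks `U ∈ 𝒰ₙ` that contains `K`, and changes `f` outside `U` to be `n`
there while keeping it on `K`. Some compact set is contained in none of the chosen sets `U`; the
functions are unbounded on it along every subsequence, so they form a closed discrete set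
(`OneWinsPre.twoWinsMarkov_closedDiscrete`).

The remaining links are the duality by which One offers all answers of Two's strategy
(`TwoWins.oneWins_dual`, `TwoWinsMarkov.oneWinsPre_dual`), the removal of `0` from the moves of One
to make closed discrete sets avoid `0` in their closure, and inclusions between the families of
moves.

If `X` is compact, it has no `k`-covers and all the conditions fail. No separate treatment is needed
except that the hyperspace is then Rothberger because its point `X` has only one neighbourhood.
-/

namespace SelectionGame

universe u

/-! ### Strategies as functions of the opponent's moves -/

section Strategies

variable {α β : Type u}

/-- The list `[f (n - 1), …, f 0]` of the first `n` values of `f`, the most recent one first. -/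
def revPrefix (f : ℕ → β) : ℕ → List β
  | 0 => []
  | n + 1 => f n :: revPrefix f n

lemma length_revPrefix (f : ℕ → β) (n : ℕ) : (revPrefix f n).length = n := by
  induction n with
  | zero => rfl
  | succ n ih => simp [revPrefix, ih]

lemma history_succ (a : ℕ → β) (b : ℕ → α) (n : ℕ) :
    history a b (n + 1) = history a b n ++ [(a n, b n)] := by
  simp [history, List.range_succ]

/-- A sequence can be prescribed by recursion on the list of its earlier values. -/
lemma exists_seq_revPrefix (F : List β → β) : ∃ f : ℕ → β, ∀ n, f n = F (revPrefix f n) := by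
  let L : ℕ → List β := fun n => n.rec [] fun _ l => F l :: l
  refine ⟨fun n => F (L n), fun n => ?_⟩
  have h : ∀ n, revPrefix (fun n => F (L n)) n = L n := fun n => by
    induction n with
    | zero => rfl
    | succ n ih => simp only [revPrefix, ih]; rfl
  simp only [h]

/-- Every list is an initial segment of some sequence with a prescribed next value. -/
lemma exists_revPrefix_eq (l : List β) (x : β) :
    ∃ f : ℕ → β, revPrefix f l.length = l ∧ f l.length = x := by
  induction l generalizing x with
  | nil => exact ⟨fun _ => x, rfl, rfl⟩
  | cons y l ih =>
    obtain ⟨f, hf, hy⟩ := ih y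
    have h : ∀ n ≤ l.length + 1, revPrefix (Function.update f (l.length + 1) x) n =
        revPrefix f n := fun n hn => by
      induction n with
      | zero => rfl
      | succ n ih =>
        rw [revPrefix, revPrefix, ih (by omega), Function.update_of_ne (by omega)]
    refine ⟨Function.update f (l.length + 1) x, ?_, by simp⟩
    rw [List.length_cons, h _ le_rfl, revPrefix, hf, hy]

/-- The history of a run in which One follows `σ`, computed from the moves of Two. -/
def historyOfTwo (σ : List (β × α) → β) : List α → List (β × α)
  | [] => []
  | b :: l => historyOfTwo σ l ++ [(σ (historyOfTwo σ l), b)]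

/-- The history of a run in which Two follows `τ`, computed from the moves of One. -/
def historyOfOne (τ : List (β × α) → β → α) : List β → List (β × α)
  | [] => []
  | a :: l => historyOfOne τ l ++ [(a, τ (historyOfOne τ l) a)]

lemma oneWins_iff {𝒜 ℬ : Set (Set α)} :
    OneWins 𝒜 ℬ ↔ ∃ σ : List α → 𝒜, ∀ b : ℕ → α,
      (∀ n, b n ∈ (σ (revPrefix b n) : Set α)) → range b ∉ ℬ := by
  constructor
  · rintro ⟨σ, hσ⟩
    refine ⟨fun l => σ (historyOfTwo σ l), fun b hb => ?_⟩
    refine hσ (fun n => σ (historyOfTwo σ (revPrefix b n))) b (fun n => ?_) hb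
    congr 1
    induction n with
    | zero => rfl
    | succ n ih => rw [history_succ, ← ih]; rfl
  · rintro ⟨σ, hσ⟩
    refine ⟨fun h => σ (h.map Prod.snd).reverse, fun a b ha hb => hσ b fun n => ?_⟩
    have h : ((history a b n).map Prod.snd).reverse = revPrefix b n := by
      induction n with
      | zero => rfl
      | succ n ih => simp [history_succ, revPrefix, ← ih]
    have hbn := hb n
    rw [ha n] at hbn
    rwa [← h]

lemma twoWins_iff {𝒜 ℬ : Set (Set α)} :
    TwoWins 𝒜 ℬ ↔ ∃ τ : List 𝒜 → 𝒜 → α, ∀ a : ℕ → 𝒜,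
      (∀ n, τ (revPrefix a n) (a n) ∈ (a n : Set α)) ∧
        range (fun n => τ (revPrefix a n) (a n)) ∈ ℬ := by
  constructor
  · rintro ⟨τ, hτ⟩
    refine ⟨fun l => τ (historyOfOne τ l), fun a => ?_⟩
    refine hτ a (fun n => τ (historyOfOne τ (revPrefix a n)) (a n)) fun n => ?_
    congr 1
    induction n with
    | zero => rfl
    | succ n ih => rw [history_succ, ← ih]; rfl
  · rintro ⟨τ, hτ⟩
    refine ⟨fun h => τ (h.map Prod.fst).reverse, fun a b hb => ?_⟩
    have h : ∀ n, ((history a b n).map Prod.fst).reverse = revPrefix a n := fun n => by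
      induction n with
      | zero => rfl
      | succ n ih => simp [history_succ, revPrefix, ← ih]
    obtain rfl : b = fun n => τ (revPrefix a n) (a n) := funext fun n => by rw [hb n, ← h n]
    exact hτ a

lemma OneWins.mono_left {𝒜 𝒜' ℬ : Set (Set α)} (h : 𝒜 ⊆ 𝒜') (H : OneWins 𝒜 ℬ) :
    OneWins 𝒜' ℬ := by
  obtain ⟨σ, hσ⟩ := oneWins_iff.1 H
  exact oneWins_iff.2 ⟨fun l => ⟨σ l, h (σ l).2⟩, hσ⟩

lemma OneWinsPre.mono_left {𝒜 𝒜' ℬ : Set (Set α)} (h : 𝒜 ⊆ 𝒜') (H : OneWinsPre 𝒜 ℬ) :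
    OneWinsPre 𝒜' ℬ := by
  obtain ⟨σ, hσ⟩ := H
  exact ⟨fun n => ⟨σ n, h (σ n).2⟩, hσ⟩

lemma OneWinsPre.oneWins {𝒜 ℬ : Set (Set α)} (H : OneWinsPre 𝒜 ℬ) : OneWins 𝒜 ℬ := by
  obtain ⟨σ, hσ⟩ := H
  refine oneWins_iff.2 ⟨fun l => σ l.length, fun b hb => hσ b fun n => ?_⟩
  simpa only [length_revPrefix] using hb n

lemma TwoWinsMarkov.twoWins {𝒜 ℬ : Set (Set α)} (H : TwoWinsMarkov 𝒜 ℬ) : TwoWins 𝒜 ℬ := by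
  obtain ⟨τ, hτ⟩ := H
  exact twoWins_iff.2 ⟨fun l A => τ A l.length, fun a => by
    simpa only [length_revPrefix] using hτ a⟩

lemma oneWinsPre_iff_not_s1 {𝒜 ℬ : Set (Set α)} : OneWinsPre 𝒜 ℬ ↔ ¬ S1 𝒜 ℬ := by
  constructor
  · rintro ⟨σ, hσ⟩ H
    obtain ⟨b, hb, hbℬ⟩ := H (fun n => σ n) fun n => (σ n).2
    exact hσ b hb hbℬ
  · intro H
    simp only [S1, not_forall] at H
    obtain ⟨A, hA, H⟩ := H
    exact ⟨fun n => ⟨A n, hA n⟩, fun b hb hbℬ => H ⟨b, hb, hbℬ⟩⟩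

/-- Two may transfer a strategy along a map that shrinks the moves of One. -/
lemma TwoWins.of_shrink {𝒜 𝒜' ℬ ℬ' : Set (Set α)} (φ : 𝒜' → 𝒜)
    (hφ : ∀ A, (φ A : Set α) ⊆ A)
    (hℬ : ∀ (a : ℕ → 𝒜') (b : ℕ → α), (∀ n, b n ∈ (φ (a n) : Set α)) → range b ∈ ℬ → range b ∈ ℬ')
    (H : TwoWins 𝒜 ℬ) : TwoWins 𝒜' ℬ' := by
  obtain ⟨τ, hτ⟩ := twoWins_iff.1 H
  refine twoWins_iff.2 ⟨fun l A => τ (l.map φ) (φ A), fun a => ?_⟩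
  have h : ∀ n, (revPrefix a n).map φ = revPrefix (φ ∘ a) n := fun n => by
    induction n with
    | zero => rfl
    | succ n ih => simp [revPrefix, ← ih]
  simp only [h]
  exact ⟨fun n => hφ _ ((hτ (φ ∘ a)).1 n), hℬ a _ (hτ (φ ∘ a)).1 (hτ (φ ∘ a)).2⟩

lemma TwoWinsMarkov.of_shrink {𝒜 𝒜' ℬ ℬ' : Set (Set α)} (φ : 𝒜' → 𝒜)
    (hφ : ∀ A, (φ A : Set α) ⊆ A)
    (hℬ : ∀ (a : ℕ → 𝒜') (b : ℕ → α), (∀ n, b n ∈ (φ (a n) : Set α)) → range b ∈ ℬ → range b ∈ ℬ')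
    (H : TwoWinsMarkov 𝒜 ℬ) : TwoWinsMarkov 𝒜' ℬ' := by
  obtain ⟨τ, hτ⟩ := H
  refine ⟨fun A => τ (φ A), fun a => ?_⟩
  exact ⟨fun n => hφ _ ((hτ (φ ∘ a)).1 n), hℬ a _ (hτ (φ ∘ a)).1 (hτ (φ ∘ a)).2⟩

/-- Duality for strategies of perfect information. If every choice function on `𝒜` has its range
in `𝒞`, then One can offer all the answers that Two's strategy may give, and decode a move of `𝒜`
from the one that is picked. -/
lemma TwoWins.oneWins_dual {𝒜 𝒞 ℬ : Set (Set α)} [Nonempty 𝒜]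
    (h𝒞 : ∀ g : 𝒜 → α, (∀ A : 𝒜, g A ∈ (A : Set α)) → range g ∈ 𝒞) (H : TwoWins 𝒜 ℬᶜ) :
    OneWins 𝒞 ℬ := by
  classical
  obtain ⟨τ, hτ⟩ := twoWins_iff.1 H
  have legal : ∀ l (A : 𝒜), τ l A ∈ (A : Set α) := fun l A => by
    obtain ⟨a, hl, hA⟩ := exists_revPrefix_eq l A
    simpa only [hl, hA] using (hτ a).1 l.length
  let pick : List 𝒜 → α → 𝒜 := fun l b => Classical.epsilon fun A => τ l A = b
  -- the moves of One in the dual game, decoded from the moves of Two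
  let dec : List α → List 𝒜 := fun l => l.foldr (fun b L => pick L b :: L) []
  refine oneWins_iff.2 ⟨fun l => ⟨range (τ (dec l)), h𝒞 _ (legal _)⟩, fun b hb => ?_⟩
  let a : ℕ → 𝒜 := fun n => pick (dec (revPrefix b n)) (b n)
  have hd : ∀ n, dec (revPrefix b n) = revPrefix a n := fun n => by
    induction n with
    | zero => rfl
    | succ n ih => rw [revPrefix, revPrefix, ← ih]; rfl
  have hab : ∀ n, τ (revPrefix a n) (a n) = b n := fun n => by
    rw [← hd]
    exact Classical.epsilon_spec (hb n)
  have h := (hτ a).2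
  simp only [hab] at h
  exact h

/-- Duality for strategies of limited information. -/
lemma TwoWinsMarkov.oneWinsPre_dual {𝒜 𝒞 ℬ : Set (Set α)}
    (h𝒞 : ∀ g : 𝒜 → α, (∀ A : 𝒜, g A ∈ (A : Set α)) → range g ∈ 𝒞) (H : TwoWinsMarkov 𝒜 ℬᶜ) :
    OneWinsPre 𝒞 ℬ := by
  obtain ⟨τ, hτ⟩ := H
  refine ⟨fun n => ⟨range fun A => τ A n, h𝒞 _ fun A => (hτ fun _ => A).1 n⟩, fun b hb => ?_⟩
  choose a ha using hb
  have h := (hτ a).2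
  simp only [ha] at h
  exact h

end Strategies

/-! ### Unions along the branches of a tree of sets -/

section Accumulate

variable {Y : Type*}

/-- The union of the sets met along the part `t` of a branch that starts at the node `s`. Nodes are
lists with the most recent entry first, so that `t ++ s` is the node reached from `s` along `t`. -/
def accumulate (G : List ℕ → ℕ → Set Y) (s : List ℕ) : List ℕ → Set Y
  | [] => ∅
  | i :: t => accumulate G s t ∪ G (t ++ s) i

lemma isOpen_accumulate [TopologicalSpace Y] {G : List ℕ → ℕ → Set Y} (ho : ∀ s m, IsOpen (G s m))
    (s t : List ℕ) : IsOpen (accumulate G s t) := by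
  induction t with
  | nil => exact isOpen_empty
  | cons i t ih => exact ih.union (ho _ _)

lemma accumulate_cons_mono {G : List ℕ → ℕ → Set Y} (hm : ∀ s, Monotone (G s)) (s t : List ℕ) :
    Monotone fun m => accumulate G s (m :: t) :=
  fun _ _ h => union_subset_union_right _ (hm _ h)

/-- Only finitely many nodes of a given level over `s` miss `y`, since the covers are increasing;
so one bound serves for all nodes of the next level. -/
lemma exists_forall_mem_accumulate {G : List ℕ → ℕ → Set Y} (hm : ∀ s, Monotone (G s))
    (hc : ∀ s y, ∃ m, y ∈ G s m) (s : List ℕ) (y : Y) (l : ℕ) :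
    ∃ m, ∀ t : List ℕ, t.length ≤ l → y ∈ accumulate G s (m :: t) := by
  choose g hg using fun t => hc (t ++ s) y
  have hfin : ∀ l, {t : List ℕ | t.length = l ∧ y ∉ accumulate G s t}.Finite := fun l => by
    induction l with
    | zero =>
      refine (finite_singleton ([] : List ℕ)).subset fun t ht => ?_
      simpa using ht.1
    | succ l ih =>
      refine (ih.biUnion fun t _ => (finite_Iio (g t)).image fun i => i :: t).subset ?_
      rintro (_ | ⟨i, t⟩) ⟨hl, hy⟩
      · simp at hl
      · simp only [accumulate, mem_union, not_or] at hy
        refine mem_biUnion (x := t) ⟨by simpa using hl, hy.1⟩ ⟨i, ?_, rfl⟩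
        by_contra hi
        exact hy.2 (hm _ (not_lt.1 hi) (hg t))
  have hfin' : {t : List ℕ | t.length ≤ l ∧ y ∉ accumulate G s t}.Finite :=
    ((finite_Iic l).biUnion fun k _ => hfin k).subset fun t ht =>
      mem_biUnion (x := t.length) ht.1 ⟨rfl, ht.2⟩
  obtain ⟨m, hM⟩ := (hfin'.image g).bddAbove
  refine ⟨m, fun t ht => ?_⟩
  by_cases hy : y ∈ accumulate G s t
  · exact Or.inl hy
  · exact Or.inr (hm _ (hM ⟨t, ⟨ht, hy⟩, rfl⟩) (hg t))

/-- The list `[f (k + d - 1), …, f k]`. -/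
def revSegment (f : ℕ → ℕ) (k : ℕ) : ℕ → List ℕ
  | 0 => []
  | d + 1 => f (k + d) :: revSegment f k d

lemma revSegment_append (f : ℕ → ℕ) (k d : ℕ) :
    revSegment f k d ++ revPrefix f k = revPrefix f (k + d) := by
  induction d with
  | zero => rfl
  | succ d ih => rw [revSegment, List.cons_append, ih]; rfl

lemma length_revSegment (f : ℕ → ℕ) (k d : ℕ) : (revSegment f k d).length = d := by
  induction d with
  | zero => rfl
  | succ d ih => simp [revSegment, ih]

lemma forall_mem_revSegment {f : ℕ → ℕ} {k d m : ℕ} (h : ∀ i < d, f (k + i) < m) :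
    ∀ x ∈ revSegment f k d, x < m := by
  induction d with
  | zero => simp [revSegment]
  | succ d ih =>
    simp only [revSegment, List.mem_cons, forall_eq_or_imp]
    exact ⟨h d (by omega), ih fun i hi => h i (by omega)⟩

lemma exists_of_mem_accumulate {G : List ℕ → ℕ → Set Y} {f : ℕ → ℕ} {k d : ℕ} {y : Y}
    (h : y ∈ accumulate G (revPrefix f k) (revSegment f k d)) :
    ∃ n ≥ k, y ∈ G (revPrefix f n) (f n) := by
  induction d with
  | zero => exact h.elim
  | succ d ih =>
    rcases h with h | h
    · exact ih h
    · rw [revSegment_append] at h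
      exact ⟨k + d, by omega, h⟩

end Accumulate

/-! ### Rothberger spaces and Pawlikowski's theorem -/

section Rothberger

variable {Y : Type*} [TopologicalSpace Y]

/-- The Rothberger property `S₁(𝒪, 𝒪)`: from every sequence of open covers one can choose one
member of each so that the chosen sets cover `Y`. Here `Y` may be a member of a cover. -/
def Rothberger (Y : Type*) [TopologicalSpace Y] : Prop :=
  ∀ 𝒰 : ℕ → Set (Set Y), (∀ n, ∀ U ∈ 𝒰 n, IsOpen U) → (∀ n y, ∃ U ∈ 𝒰 n, y ∈ U) →
    ∃ U : ℕ → Set Y, (∀ n, U n ∈ 𝒰 n) ∧ ∀ y, ∃ n, y ∈ U n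

/-- In a Rothberger space one selection can be made to cover along each of countably many disjoint
blocks of indices, the `a`-th block being `{Nat.pair a j : j ∈ ω}`. -/
lemma Rothberger.exists_selection_blocks (hY : Rothberger Y) {ι : Type*} (W : ℕ → ι → Set Y)
    (p : ℕ → ι → Prop) (ho : ∀ n i, p n i → IsOpen (W n i))
    (hc : ∀ n y, ∃ i, p n i ∧ y ∈ W n i) :
    ∃ c : ℕ → ι, (∀ n, p n (c n)) ∧ ∀ a y, ∃ j, y ∈ W (Nat.pair a j) (c (Nat.pair a j)) := by
  have key : ∀ a, ∃ c : ℕ → ι, (∀ j, p (Nat.pair a j) (c j)) ∧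
      ∀ y, ∃ j, y ∈ W (Nat.pair a j) (c j) := fun a => by
    obtain ⟨U, hU, hcov⟩ := hY (fun j => W (Nat.pair a j) '' {i | p (Nat.pair a j) i})
      (fun j U hU => by obtain ⟨i, hi, rfl⟩ := hU; exact ho _ i hi)
      (fun j y => by
        obtain ⟨i, hi, hy⟩ := hc (Nat.pair a j) y
        exact ⟨_, ⟨i, hi, rfl⟩, hy⟩)
    choose c hc hcU using hU
    exact ⟨c, hc, fun y => by simpa only [hcU] using hcov y⟩
  choose c hp hcov using key
  refine ⟨fun n => c n.unpair.1 n.unpair.2, fun n => ?_, fun a y => ?_⟩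
  · simpa using hp n.unpair.1 n.unpair.2
  · obtain ⟨j, hj⟩ := hcov a y
    exact ⟨j, by simpa using hj⟩

/-- Hurewicz's theorem on the Menger game, for Rothberger spaces: if every node of the tree of
finite sequences carries an increasing open cover, then some branch `f` covers every point
infinitely often. The covers to select from say that a number is large enough, at bounded depth
over a given node; the first place where the branch reaches that number is the place where it
covers the point. -/
lemma Rothberger.exists_branch (hY : Rothberger Y) {G : List ℕ → ℕ → Set Y}
    (ho : ∀ s m, IsOpen (G s m)) (hm : ∀ s, Monotone (G s)) (hc : ∀ s y, ∃ m, y ∈ G s m) :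
    ∃ f : ℕ → ℕ, ∀ y k, ∃ n ≥ k, y ∈ G (revPrefix f n) (f n) := by
  -- the node attached to an index `n = Nat.pair (Nat.pair (encode s) k) j`
  let node : ℕ → List ℕ := fun n => (Encodable.decode n.unpair.1.unpair.1).getD []
  let W : ℕ → ℕ → Set Y := fun n m =>
    {y | ∀ t : List ℕ, t.length ≤ n → (∀ i ∈ t, i < m) → y ∈ accumulate G (node n) (m :: t)}
  have hWo : ∀ n m, IsOpen (W n m) := fun n m => by
    have hfin : {t : List ℕ | t.length ≤ n ∧ ∀ i ∈ t, i < m}.Finite := by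
      refine ((List.finite_length_le (Fin m) n).image (List.map Fin.val)).subset ?_
      rintro t ⟨htl, htm⟩
      refine ⟨t.pmap Fin.mk htm, by simpa using htl, ?_⟩
      simp [List.map_pmap]
    have : W n m = ⋂ t ∈ {t : List ℕ | t.length ≤ n ∧ ∀ i ∈ t, i < m},
        accumulate G (node n) (m :: t) := by
      ext y
      simp [W]
    rw [this]
    exact hfin.isOpen_biInter fun t _ => isOpen_accumulate ho _ _
  obtain ⟨f, -, hf⟩ := hY.exists_selection_blocks W (fun _ _ => True) (fun n m _ => hWo n m)
    fun n y => by
      obtain ⟨m, h⟩ := exists_forall_mem_accumulate hm hc (node n) y n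
      exact ⟨m, trivial, fun t ht _ => h t ht⟩
  refine ⟨f, fun y k => ?_⟩
  obtain ⟨j, hj⟩ := hf (Nat.pair (Encodable.encode (revPrefix f k)) k) y
  set n := Nat.pair (Nat.pair (Encodable.encode (revPrefix f k)) k) j with hn
  have hkn : k ≤ n := (Nat.right_le_pair _ _).trans (Nat.left_le_pair _ _)
  have hnode : node n = revPrefix f k := by simp [node, hn]
  have hex : ∃ d, f n ≤ f (k + d) := ⟨n - k, by rw [Nat.add_sub_cancel' hkn]⟩
  classical
  -- the first place after `k` where the branch reaches the value `f n`
  have hdn : Nat.find hex ≤ n :=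
    (Nat.find_min' hex (by rw [Nat.add_sub_cancel' hkn])).trans (Nat.sub_le n k)
  have h := hj (revSegment f k (Nat.find hex)) (by rwa [length_revSegment])
    (forall_mem_revSegment fun i hi => not_le.1 (Nat.find_min hex hi))
  rw [hnode] at h
  exact exists_of_mem_accumulate (d := Nat.find hex + 1)
    (accumulate_cons_mono hm _ _ (Nat.find_spec hex) h)

lemma finite_forall₂_le (s : List ℕ) : {r : List ℕ | List.Forall₂ (· ≤ ·) r s}.Finite := by
  induction s with
  | nil => exact (finite_singleton []).subset fun r hr => by simpa using hr
  | cons m s ih =>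
    refine (((finite_Iic m).prod ih).image fun p => p.1 :: p.2).subset ?_
    rintro _ (_ | ⟨h1, h2⟩)
    exact ⟨(_, _), ⟨h1, h2⟩, rfl⟩

/-- Sets of sizes `1, 2, 3, …` have pairwise distinct representatives. -/
lemma exists_injective_of_card {S : ℕ → Finset ℕ} (hS : ∀ k, (S k).card = k + 1) :
    ∃ N : ℕ → ℕ, Function.Injective N ∧ ∀ k, N k ∈ S k := by
  refine (Finset.all_card_le_biUnion_card_iff_exists_injective S).1 fun s => ?_
  rcases s.eq_empty_or_nonempty with rfl | hs
  · simp
  · have h1 : s.card ≤ s.max' hs + 1 := by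
      simpa using Finset.card_le_card fun i hi =>
        Finset.mem_range.2 (Nat.lt_succ_of_le (s.le_max' i hi))
    rw [← hS (s.max' hs)] at h1
    exact h1.trans (Finset.card_le_card (Finset.subset_biUnion_of_mem S (s.max'_mem hs)))

/-- Pawlikowski's theorem for trees of countable covers: if every node of the tree of finite
sequences carries an open cover, then some branch of the tree covers every point infinitely often.

A branch `f` as in `Rothberger.exists_branch` bounds finitely many nodes of each level, and the
children of all of these, up to `f`, cover each point on infinitely many levels. A set `V` is then
selected for each `k`, which prescribes children on `k + 1` levels. As `V` need be used on one of
its levels only, different levels can be used for different `k`. -/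
lemma Rothberger.exists_branch_of_cover (hY : Rothberger Y) {U : List ℕ → ℕ → Set Y}
    (ho : ∀ s i, IsOpen (U s i)) (hc : ∀ s y, ∃ i, y ∈ U s i) :
    ∃ g : ℕ → ℕ, ∀ y, {n | y ∈ U (revPrefix g n) (g n)}.Infinite := by
  classical
  let P : List ℕ → Set (List ℕ) := fun s => {r | List.Forall₂ (· ≤ ·) r s}
  have hP : ∀ s, (P s).Finite := finite_forall₂_le
  let G : List ℕ → ℕ → Set Y := fun s m => {y | ∀ r ∈ P s, ∃ i ≤ m, y ∈ U r i}
  obtain ⟨f, hf⟩ := hY.exists_branch (G := G)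
    (fun s m => by
      have : G s m = ⋂ r ∈ P s, ⋃ i ∈ Iic m, U r i := by ext y; simp [G]
      rw [this]
      exact (hP s).isOpen_biInter fun r _ => isOpen_biUnion fun i _ => ho r i)
    (fun s m m' h y hy r hr => by
      obtain ⟨i, hi, hyi⟩ := hy r hr
      exact ⟨i, hi.trans h, hyi⟩)
    (fun s y => by
      choose c hc using fun r => hc r y
      obtain ⟨m, hm⟩ := ((hP s).image c).bddAbove
      exact ⟨m, fun r hr => ⟨c r, hm ⟨r, hr, rfl⟩, hc r⟩⟩)
  -- `S` is a set of `k + 1` levels, and `φ` prescribes a child for every node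
  let V : ℕ → Finset ℕ × (List ℕ → ℕ) → Set Y := fun _ q =>
    {y | ∀ n ∈ q.1, ∀ r ∈ P (revPrefix f n), y ∈ U r (q.2 r)}
  let p : ℕ → Finset ℕ × (List ℕ → ℕ) → Prop := fun k q =>
    q.1.card = k + 1 ∧ ∀ n ∈ q.1, ∀ r ∈ P (revPrefix f n), q.2 r ≤ f n
  obtain ⟨c, hpc, hVc⟩ := hY.exists_selection_blocks V p
    (fun k q _ => by
      have : V k q = ⋂ n ∈ (q.1 : Set ℕ), ⋂ r ∈ P (revPrefix f n), U r (q.2 r) := by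
        ext y; simp [V]
      rw [this]
      exact q.1.finite_toSet.isOpen_biInter fun n _ =>
        (hP _).isOpen_biInter fun r _ => ho r _)
    (fun k y => by
      have hinf : {n | y ∈ G (revPrefix f n) (f n)}.Infinite :=
        
        Nat.frequently_atTop_iff_infinite.1 (Filter.frequently_atTop.2 (hf y))
      obtain ⟨S, hS, hcard⟩ := hinf.exists_subset_card_eq (k + 1)
      refine ⟨(S, fun r => Nat.find (hc r y)), ⟨hcard, fun n hn r hr => ?_⟩,
        fun n _ r _ => Nat.find_spec (hc r y)⟩
      obtain ⟨i, hi, hyi⟩ := hS hn r hr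
      exact (Nat.find_min' _ hyi).trans hi)
  obtain ⟨N, hN, hNS⟩ := exists_injective_of_card fun k => (hpc k).1
  -- on level `N k` the branch follows the `k`-th prescription
  let ψ : List ℕ → ℕ := fun r =>
    if h : ∃ k, N k = r.length then (c h.choose).2 r else 0
  have hψ : ∀ k r, r.length = N k → ψ r = (c k).2 r := fun k r hr => by
    have h : ∃ k, N k = r.length := ⟨k, hr.symm⟩
    have : h.choose = k := hN (h.choose_spec.trans hr)
    simp only [ψ, dif_pos h, this]
  obtain ⟨g, hg⟩ := exists_seq_revPrefix ψ
  have hgP : ∀ n, revPrefix g n ∈ P (revPrefix f n) := fun n => by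
    induction n with
    | zero => exact List.Forall₂.nil
    | succ n ih =>
      refine List.Forall₂.cons ?_ ih
      rw [hg n]
      by_cases h : ∃ k, N k = n
      · obtain ⟨k, hk⟩ := h
        rw [hψ k _ (by rw [length_revPrefix, hk])]
        exact (hpc k).2 n (hk ▸ hNS k) _ ih
      · simp [ψ, length_revPrefix, h]
  refine ⟨g, fun y => ?_⟩
  have hinf : {k | y ∈ V k (c k)}.Infinite :=
    Nat.frequently_atTop_iff_infinite.1 <| Filter.frequently_atTop.2 fun a => by
      obtain ⟨j, hj⟩ := hVc a y
      exact ⟨_, Nat.left_le_pair a j, hj⟩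
  refine (hinf.image hN.injOn).mono ?_
  rintro _ ⟨k, hk, rfl⟩
  have := hk (N k) (hNS k) _ (hgP (N k))
  rwa [← hψ k _ (length_revPrefix g _), ← hg] at this

/-- In a Rothberger space, Two can beat each single strategy of One in the game of choosing from
open covers; One's moves are here sets `A l` of labels, depending on the previous choices `l`, and
the label `b` stands for the open set `O l b`. -/
theorem Rothberger.exists_play (hY : Rothberger Y) {α : Type*} (A : List α → Set α)
    (O : List α → α → Set Y) (ho : ∀ l, ∀ b ∈ A l, IsOpen (O l b))
    (hc : ∀ l y, ∃ b ∈ A l, y ∈ O l b) :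
    ∃ b : ℕ → α, (∀ n, b n ∈ A (revPrefix b n)) ∧
      ∀ y, {n | y ∈ O (revPrefix b n) (b n)}.Infinite := by
  -- Rothberger spaces are Lindelöf
  have hL : ∀ l, ∃ e : ℕ → α, (∀ i, e i ∈ A l) ∧ ∀ y, ∃ i, y ∈ O l (e i) := fun l => by
    obtain ⟨c, hcA, hcov⟩ := hY.exists_selection_blocks (fun _ => O l) (fun _ b => b ∈ A l)
      (fun _ => ho l) (fun _ => hc l)
    exact ⟨c, hcA, fun y => (hcov 0 y).imp' _ fun _ h => h⟩
  choose e heA hecov using hL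
  let dec : List ℕ → List α := fun s => s.foldr (fun i l => e l i :: l) []
  obtain ⟨g, hg⟩ := hY.exists_branch_of_cover (U := fun s i => O (dec s) (e (dec s) i))
    (fun s i => ho _ _ (heA _ i)) (fun s => hecov _)
  have hd : ∀ n, dec (revPrefix g n) =
      revPrefix (fun n => e (dec (revPrefix g n)) (g n)) n := fun n => by
    induction n with
    | zero => rfl
    | succ n ih => rw [revPrefix, revPrefix, ← ih]; rfl
  refine ⟨fun n => e (dec (revPrefix g n)) (g n), fun n => ?_, fun y => ?_⟩
  · rw [← hd]
    exact heA _ _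
  · simpa only [← hd] using hg y

end Rothberger

/-! ### The hyperspace of compact sets -/

section Hyperspace

variable {X : Type u} [TopologicalSpace X]

/-- The compact subsets of `X`, with the upper Vietoris topology: the sets `{K | K ⊆ U}` for open
`U ⊆ X` form a basis. -/
def CompactHyperspace (X : Type u) [TopologicalSpace X] : Type u :=
  {K : Set X // IsCompact K}

namespace CompactHyperspace

/-- The set of compact sets that are contained in `U`. -/
def below (U : Set X) : Set (CompactHyperspace X) :=
  {K | K.1 ⊆ U}

instance : TopologicalSpace (CompactHyperspace X) :=
  TopologicalSpace.generateFrom {V | ∃ U : Set X, IsOpen U ∧ V = below U}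

lemma isOpen_below {U : Set X} (hU : IsOpen U) : IsOpen (below U) :=
  TopologicalSpace.isOpen_generateFrom_of_mem ⟨U, hU, rfl⟩

lemma isTopologicalBasis :
    TopologicalSpace.IsTopologicalBasis
      {V : Set (CompactHyperspace X) | ∃ U : Set X, IsOpen U ∧ V = below U} where
  exists_subset_inter := by
    rintro _ ⟨U, hU, rfl⟩ _ ⟨U', hU', rfl⟩ K hK
    exact ⟨below (U ∩ U'), ⟨_, hU.inter hU', rfl⟩, subset_inter hK.1 hK.2,
      fun L hL => ⟨hL.trans inter_subset_left, hL.trans inter_subset_right⟩⟩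
  sUnion_eq := eq_univ_of_forall fun K => ⟨below univ, ⟨_, isOpen_univ, rfl⟩, subset_univ K.1⟩
  eq_generateFrom := rfl

end CompactHyperspace

lemma mem_kCovers {𝒰 : Set (Set X)} (ho : ∀ U ∈ 𝒰, IsOpen U) (hu : univ ∉ 𝒰)
    (hK : ∀ K : Set X, IsCompact K → ∃ U ∈ 𝒰, K ⊆ U) : 𝒰 ∈ kCovers X := by
  refine ⟨⟨ho, eq_univ_of_forall fun x => ?_, hu⟩, hK⟩
  obtain ⟨U, hU, hx⟩ := hK {x} isCompact_singleton
  exact ⟨U, hU, hx rfl⟩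

open CompactHyperspace in
/-- A compact `X` is a point of the hyperspace all of whose neighbourhoods are the whole
hyperspace, which is then Rothberger for a trivial reason. Otherwise the basic open sets `below U`
with `U ≠ univ` suffice to refine open covers of the hyperspace, and they come from `k`-covers. -/
lemma S1.rothberger_compactHyperspace [T1Space X] (H : S1 (kCovers X) (kCovers X)) :
    Rothberger (CompactHyperspace X) := by
  intro 𝒰 ho hc
  by_cases hX : IsCompact (univ : Set X)
  · choose U hU hUX using fun n => hc n ⟨univ, hX⟩
    refine ⟨U, hU, fun K => ⟨0, ?_⟩⟩
    obtain ⟨_, ⟨V, hV, rfl⟩, hXV, hVU⟩ :=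
      isTopologicalBasis.exists_subset_of_mem_open (hUX 0) (ho 0 _ (hU 0))
    exact hVU ((subset_univ K.1).trans hXV)
  · obtain ⟨b, hb, hbk⟩ := H
      (fun n => {V | IsOpen V ∧ V ≠ univ ∧ ∃ U ∈ 𝒰 n, below V ⊆ U}) fun n => by
        refine mem_kCovers (fun V hV => hV.1) (fun h => h.2.1 rfl) fun K hK => ?_
        obtain ⟨U, hU, hKU⟩ := hc n ⟨K, hK⟩
        obtain ⟨_, ⟨V, hV, rfl⟩, hKV, hVU⟩ :=
          isTopologicalBasis.exists_subset_of_mem_open hKU (ho n _ hU)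
        obtain ⟨x, hx⟩ : ∃ x, x ∉ K := by
          by_contra! h
          exact hX (eq_univ_of_forall h ▸ hK)
        refine ⟨V \ {x}, ⟨hV.sdiff isClosed_singleton, fun h => ?_, U, hU, fun L hL => ?_⟩,
          subset_sdiff_singleton hKV hx⟩
        · exact (h ▸ mem_univ x : x ∈ V \ {x}).2 rfl
        · exact hVU (hL.trans sdiff_subset)
    choose U hU hbU using fun n => (hb n).2.2
    refine ⟨U, hU, fun K => ?_⟩
    obtain ⟨_, ⟨n, rfl⟩, hK⟩ := hbk.2 K.1 K.2
    exact ⟨n, hbU n hK⟩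

end Hyperspace

/-! ### Games on the covers of a space -/

section Covers

variable {X : Type u} [TopologicalSpace X]

lemma OneWinsPre.twoWinsMarkov_compactNhds (H : OneWinsPre (kCovers X) (kCovers X)) :
    TwoWinsMarkov (compactNhds X) (kCovers X)ᶜ := by
  obtain ⟨σ, hσ⟩ := H
  have key : ∀ (A : compactNhds X) n, ∃ U ∈ (A : Set (Set X)), U ∈ (σ n : Set (Set X)) := by
    rintro ⟨_, K, hK, rfl⟩ n
    obtain ⟨U, hU, hKU⟩ := (σ n).2.2 K hK.2
    exact ⟨U, ⟨(σ n).2.1.1 U hU, hKU, fun h => (σ n).2.1.2.2 (h ▸ hU)⟩, hU⟩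
  choose τ hτ hτσ using key
  exact ⟨τ, fun a => ⟨fun n => hτ _ _, hσ _ fun n => hτσ _ _⟩⟩

lemma TwoWins.oneWins_kCovers [Nonempty X] (H : TwoWins (compactNhds X) (kCovers X)ᶜ) :
    OneWins (kCovers X) (kCovers X) := by
  have : Nonempty (compactNhds X) :=
    ⟨⟨_, {Classical.arbitrary X}, ⟨singleton_nonempty _, isCompact_singleton⟩, rfl⟩⟩
  refine H.oneWins_dual fun g hg => ?_
  have hg' : ∀ A, IsOpen (g A) ∧ g A ≠ univ := by
    rintro ⟨A, K, hK, rfl⟩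
    exact ⟨(hg ⟨_, K, hK, rfl⟩).1, (hg ⟨_, K, hK, rfl⟩).2.2⟩
  refine mem_kCovers ?_ ?_ fun K hK => ?_
  · rintro _ ⟨A, rfl⟩
    exact (hg' A).1
  · rintro ⟨A, hA⟩
    exact (hg' A).2 hA
  -- the empty set is contained in everything, but is no move of One
  · rcases K.eq_empty_or_nonempty with rfl | hne
    · exact ⟨_, ⟨this.some, rfl⟩, empty_subset _⟩
    · exact ⟨_, ⟨⟨_, K, ⟨hne, hK⟩, rfl⟩, rfl⟩, (hg ⟨_, K, ⟨hne, hK⟩, rfl⟩).2.1⟩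

/-- The analogue for `k`-covers of Pawlikowski's theorem. -/
lemma OneWins.not_s1_kCovers [T1Space X] (H : OneWins (kCovers X) (kCovers X)) :
    ¬ S1 (kCovers X) (kCovers X) := by
  intro hS
  obtain ⟨σ, hσ⟩ := oneWins_iff.1 H
  obtain ⟨b, hb, hcov⟩ := hS.rothberger_compactHyperspace.exists_play (fun l => (σ l).1)
    (fun _ U => CompactHyperspace.below U)
    (fun l U hU => CompactHyperspace.isOpen_below ((σ l).2.1.1 U hU))
    (fun l K => (σ l).2.2 K.1 K.2)
  refine hσ b hb (mem_kCovers ?_ ?_ fun K hK => ?_)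
  · rintro _ ⟨n, rfl⟩
    exact (σ _).2.1.1 _ (hb n)
  · rintro ⟨n, hn⟩
    exact (σ _).2.1.2.2 (hn ▸ hb n)
  · obtain ⟨n, hn⟩ := (hcov ⟨K, hK⟩).nonempty
    exact ⟨_, ⟨n, rfl⟩, hn⟩

end Covers

/-! ### Games on spaces of continuous functions -/

section FunctionSpace

variable {X : Type u} [TopologicalSpace X]

lemma mem_nhds_continuousMap_iff {f : C(X, ℝ)} {N : Set C(X, ℝ)} :
    N ∈ nhds f ↔ ∃ K : Set X, IsCompact K ∧ ∃ ε > 0,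
      {g : C(X, ℝ) | ∀ x ∈ K, |g x - f x| < ε} ⊆ N := by
  rw [(nhds_basis_uniformity'
    Metric.uniformity_basis_dist.compactConvergenceUniformity).mem_iff]
  simp only [Prod.exists, and_assoc, exists_and_left]
  refine exists_congr fun K => and_congr_right fun _ => exists_congr fun ε =>
    and_congr_right fun _ => ?_
  have : UniformSpace.ball f {fg : C(X, ℝ) × C(X, ℝ) |
      ∀ x ∈ K, (fg.1 x, fg.2 x) ∈ {p : ℝ × ℝ | dist p.1 p.2 < ε}} =
      {g : C(X, ℝ) | ∀ x ∈ K, |g x - f x| < ε} := by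
    ext g
    simp [UniformSpace.ball, Real.dist_eq, abs_sub_comm]
  rw [← this]

lemma mem_blades_zero_iff {A : Set C(X, ℝ)} :
    A ∈ blades (0 : C(X, ℝ)) ↔
      ∀ K : Set X, IsCompact K → ∀ ε > 0, ∃ f ∈ A, ∀ x ∈ K, |f x| < ε := by
  rw [blades, mem_ofPred_eq, mem_closure_iff_nhds]
  constructor
  · intro h K hK ε hε
    obtain ⟨f, hf, hfA⟩ := h _ (mem_nhds_continuousMap_iff.2 ⟨K, hK, ε, hε, Subset.rfl⟩)
    exact ⟨f, hfA, fun x hx => by simpa using hf x hx⟩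
  · intro h N hN
    obtain ⟨K, hK, ε, hε, hKN⟩ := mem_nhds_continuousMap_iff.1 hN
    obtain ⟨f, hfA, hf⟩ := h K hK ε hε
    exact ⟨f, hKN fun x hx => by simpa using hf x hx, hfA⟩

/-- In a completely regular space, a compact set can be separated by a continuous function from
the complement of any of its open neighbourhoods. -/
lemma exists_continuousMap_eq_zero_eq_one [CompletelyRegularSpace X] {K U : Set X}
    (hK : IsCompact K) (hU : IsOpen U) (hKU : K ⊆ U) :
    ∃ h : C(X, ℝ), (∀ x ∈ K, h x = 0) ∧ ∀ x ∉ U, h x = 1 := by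
  refine hK.induction_on (p := fun s => ∃ h : C(X, ℝ), (∀ x ∈ s, h x = 0) ∧ ∀ x ∉ U, h x = 1)
    ⟨1, by simp, by simp⟩ ?_ ?_ fun x hx => ?_
  · rintro s t hst ⟨h, h0, h1⟩
    exact ⟨h, fun x hx => h0 x (hst hx), h1⟩
  · rintro s t ⟨h, h0, h1⟩ ⟨h', h0', h1'⟩
    refine ⟨h * h', ?_, fun x hx => by simp [h1 x hx, h1' x hx]⟩
    rintro x (hx | hx)
    · simp [h0 x hx]
    · simp [h0' x hx]
  · obtain ⟨g, hg, hgx, hg1⟩ := CompletelyRegularSpace.completely_regular x Uᶜ hU.isClosed_compl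
      (not_not.2 (hKU hx))
    have hgc : Continuous fun x => (g x : ℝ) := continuous_subtype_val.comp hg
    -- the truncation vanishes on a neighbourhood of `x`, where `g < 1 / 2`
    refine ⟨{y | (g y : ℝ) < 1 / 2}, mem_nhdsWithin_of_mem_nhds
      ((isOpen_lt hgc continuous_const).mem_nhds (by simp [hgx])),
      ⟨fun y => max 0 (2 * (g y : ℝ) - 1), by fun_prop⟩, fun y hy => ?_, fun y hy => ?_⟩
    · have : (g y : ℝ) < 1 / 2 := hy
      exact max_eq_left (by linarith)
    · have : (g y : ℝ) = 1 := by rw [hg1 hy]; rfl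
      norm_num [this]

/-- A sequence of functions that is large, along the whole sequence, somewhere on one and the same
compact set is closed and discrete. -/
lemma range_mem_closedDiscrete {b : ℕ → C(X, ℝ)} {K : Set X} (hK : IsCompact K)
    (hb : ∀ n : ℕ, ∃ x ∈ K, b n x = n) : range b ∈ closedDiscrete C(X, ℝ) := by
  have hlf : LocallyFinite fun n => ({b n} : Set C(X, ℝ)) := fun h => by
    obtain ⟨M, hM⟩ := (hK.image_of_continuousOn h.continuous.continuousOn).bddAbove
    refine ⟨_, mem_nhds_continuousMap_iff.2 ⟨K, hK, 1, one_pos, Subset.rfl⟩, ?_⟩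
    refine (finite_Iio ⌈M + 1⌉₊).subset ?_
    rintro n ⟨_, rfl, hn⟩
    obtain ⟨x, hx, hbx⟩ := hb n
    have h1 := (abs_lt.1 (hn x hx)).2
    have h2 : h x ≤ M := hM ⟨x, hx, rfl⟩
    rw [hbx] at h1
    exact Nat.lt_ceil.2 (by linarith)
  have hcl : ∀ S ⊆ range b, IsClosed S := fun S hS => by
    have : S = ⋃ n, ({b n} ∩ S) := by
      rw [← iUnion_inter, iUnion_singleton_eq_range, inter_eq_right.2 hS]
    rw [this]
    refine (hlf.subset fun n => inter_subset_left).isClosed_iUnion fun n => ?_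
    exact ((finite_singleton (b n)).subset inter_subset_left).isClosed
  refine ⟨hcl _ Subset.rfl, discreteTopology_iff_forall_isClosed.2 fun S => ?_⟩
  have := (hcl (Subtype.val '' S) (by rintro _ ⟨f, -, rfl⟩; exact f.2)).preimage
    (continuous_subtype_val (p := fun f => f ∈ range b))
  rwa [preimage_image_eq _ Subtype.val_injective] at this

/-- Two modifies a function outside a member of One's winning sequence of `k`-covers, so as to be
`n` there. -/
lemma OneWinsPre.twoWinsMarkov_closedDiscrete [CompletelyRegularSpace X]
    (H : OneWinsPre (kCovers X) (kCovers X)) :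
    TwoWinsMarkov (nonemptyOpens C(X, ℝ)) (closedDiscrete C(X, ℝ)) := by
  obtain ⟨σ, hσ⟩ := H
  have key : ∀ (A : nonemptyOpens C(X, ℝ)) (n : ℕ), ∃ g ∈ (A : Set C(X, ℝ)),
      ∃ U ∈ (σ n : Set (Set X)), ∀ x ∉ U, g x = n := by
    rintro ⟨A, hA, f, hf⟩ n
    obtain ⟨K, hK, ε, hε, hKA⟩ := mem_nhds_continuousMap_iff.1 (hA.mem_nhds hf)
    obtain ⟨U, hU, hKU⟩ := (σ n).2.2 K hK
    obtain ⟨h, h0, h1⟩ := exists_continuousMap_eq_zero_eq_one hK ((σ n).2.1.1 U hU) hKU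
    refine ⟨f + h * (ContinuousMap.const X (n : ℝ) - f), hKA fun x hx => ?_, U, hU, fun x hx => ?_⟩
    · simpa [h0 x hx] using hε
    · simp [h1 x hx]
  choose τ hτA U hU hτ using key
  refine ⟨τ, fun a => ⟨fun n => hτA _ _, ?_⟩⟩
  -- as the selected sets do not form a `k`-cover, some compact set meets all their complements
  obtain ⟨K, hK, hKU⟩ : ∃ K : Set X, IsCompact K ∧ ∀ n, ¬ K ⊆ U (a n) n := by
    by_contra! h
    refine hσ _ (fun n => hU (a n) n) (mem_kCovers ?_ ?_ fun K hK => ?_)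
    · rintro _ ⟨n, rfl⟩
      exact (σ n).2.1.1 _ (hU _ _)
    · rintro ⟨n, hn⟩
      exact (σ n).2.1.2.2 (hn ▸ hU (a n) n)
    · obtain ⟨n, hn⟩ := h K hK
      exact ⟨_, ⟨n, rfl⟩, hn⟩
  refine range_mem_closedDiscrete hK fun n => ?_
  obtain ⟨x, hx, hxU⟩ := not_subset.1 (hKU n)
  exact ⟨x, hx, hτ _ _ x hxU⟩

lemma nonempty_sdiff_zero [Nonempty X] {A : Set C(X, ℝ)} (hA : A ∈ nonemptyOpens C(X, ℝ)) :
    A \ {0} ∈ nonemptyOpens C(X, ℝ) := by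
  refine ⟨hA.1.sdiff isClosed_singleton, ?_⟩
  obtain ⟨f, hf⟩ := hA.2
  by_cases hf0 : f = 0
  · obtain ⟨K, hK, ε, hε, hKA⟩ := mem_nhds_continuousMap_iff.1 (hA.1.mem_nhds hf)
    refine ⟨ContinuousMap.const X (ε / 2), hKA fun x _ => ?_, fun h => ?_⟩
    · simpa [hf0, abs_of_pos (half_pos hε)] using half_lt_self hε
    · have := DFunLike.congr_fun h (Classical.arbitrary X)
      simp [hε.ne'] at this
  · exact ⟨f, hf, hf0⟩

/-- One's moves with the zero function removed. -/
def removeZero [Nonempty X] (A : nonemptyOpens C(X, ℝ)) : nonemptyOpens C(X, ℝ) :=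
  ⟨_, nonempty_sdiff_zero A.2⟩

/-- A closed set that avoids `0` does not have `0` in its closure. -/
lemma range_notMem_blades [Nonempty X] (a : ℕ → nonemptyOpens C(X, ℝ)) (b : ℕ → C(X, ℝ))
    (hb : ∀ n, b n ∈ (removeZero (a n) : Set C(X, ℝ))) (h : range b ∈ closedDiscrete C(X, ℝ)) :
    range b ∈ (blades (0 : C(X, ℝ)))ᶜ := by
  intro h0
  have h0' : (0 : C(X, ℝ)) ∈ closure (range b) := h0
  rw [h.1.closure_eq] at h0'
  obtain ⟨n, hn⟩ := h0'
  exact (hb n).2 hn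

lemma TwoWins.blades_of_closedDiscrete [Nonempty X]
    (H : TwoWins (nonemptyOpens C(X, ℝ)) (closedDiscrete C(X, ℝ))) :
    TwoWins (nonemptyOpens C(X, ℝ)) (blades (0 : C(X, ℝ)))ᶜ :=
  H.of_shrink removeZero (fun _ => sdiff_subset) range_notMem_blades

lemma TwoWinsMarkov.blades_of_closedDiscrete [Nonempty X]
    (H : TwoWinsMarkov (nonemptyOpens C(X, ℝ)) (closedDiscrete C(X, ℝ))) :
    TwoWinsMarkov (nonemptyOpens C(X, ℝ)) (blades (0 : C(X, ℝ)))ᶜ :=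
  H.of_shrink removeZero (fun _ => sdiff_subset) range_notMem_blades

/-- A sequence whose `n`-th member lies within `1 / (n + 1)` of `0` on each compact set for
infinitely many `n` clusters at `0`; such a sequence is a play against One in the game on the
hyperspace. -/
lemma OneWins.not_s1_kCovers_of_blades [T1Space X]
    (H : OneWins (blades (0 : C(X, ℝ))) (blades (0 : C(X, ℝ)))) :
    ¬ S1 (kCovers X) (kCovers X) := by
  intro hS
  obtain ⟨σ, hσ⟩ := oneWins_iff.1 H
  obtain ⟨b, hb, hcov⟩ := hS.rothberger_compactHyperspace.exists_play (fun l => (σ l).1)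
    (fun l f => CompactHyperspace.below {x | |f x| < 1 / ((l.length : ℝ) + 1)})
    (fun l f _ => CompactHyperspace.isOpen_below
      (isOpen_lt (by fun_prop) continuous_const))
    (fun l K => mem_blades_zero_iff.1 (σ l).2 K.1 K.2 _ (by positivity))
  refine hσ b hb (mem_blades_zero_iff.2 fun K hK ε hε => ?_)
  obtain ⟨N, hN⟩ := exists_nat_one_div_lt hε
  obtain ⟨n, hn, hNn⟩ := (hcov ⟨K, hK⟩).exists_gt N
  refine ⟨b n, ⟨n, rfl⟩, fun x hx => ?_⟩
  have h : |b n x| < 1 / (((revPrefix b n).length : ℝ) + 1) := hn hx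
  rw [length_revPrefix] at h
  exact h.trans ((one_div_le_one_div_of_le (by positivity) (by gcongr)).trans_lt hN)

end FunctionSpace

/-! ### Games in a topological space at a point -/

section Point

variable {Y : Type u} [TopologicalSpace Y] {y : Y}

lemma range_mem_blades_of_openNhds (g : openNhds y → Y) (hg : ∀ A : openNhds y, g A ∈ (A : Set Y)) :
    range g ∈ blades y :=
  mem_closure_iff.2 fun U hU hy => ⟨_, hg ⟨U, hU, hy⟩, ⟨_, rfl⟩⟩

lemma range_mem_denseSets (g : nonemptyOpens Y → Y)
    (hg : ∀ A : nonemptyOpens Y, g A ∈ (A : Set Y)) : range g ∈ denseSets Y :=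
  dense_iff_inter_open.2 fun U hU hne => ⟨_, hg ⟨U, hU, hne⟩, ⟨_, rfl⟩⟩

lemma denseSets_subset_blades : denseSets Y ⊆ blades y := fun _ hD => hD y

lemma openNhds_subset_nonemptyOpens : openNhds y ⊆ nonemptyOpens Y := fun _ hU => ⟨hU.1, y, hU.2⟩

/-- Selection principles at the points of a topological group do not depend on the point. -/
lemma s1_blades_of_translate {G : Type u} [TopologicalSpace G] [AddGroup G]
    [IsTopologicalAddGroup G] {𝒜 𝒜' : Set (Set G)} (y : G)
    (h𝒜 : ∀ A ∈ 𝒜, Homeomorph.addRight (-y) '' A ∈ 𝒜') (H : S1 𝒜' (blades (0 : G))) :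
    S1 𝒜 (blades y) := by
  intro A hA
  obtain ⟨b, hb, hb0⟩ := H (fun n => Homeomorph.addRight (-y) '' A n) fun n => h𝒜 _ (hA n)
  choose c hc hcb using hb
  refine ⟨c, hc, ?_⟩
  have h : range b = Homeomorph.addRight (-y) '' range c := by
    rw [← range_comp]
    exact congrArg range (funext fun n => (hcb n).symm)
  rw [h, blades, mem_ofPred_eq, ← Homeomorph.image_closure] at hb0
  obtain ⟨z, hz, hz0⟩ := hb0
  obtain rfl : z = y := by simpa [add_neg_eq_zero] using hz0
  exact hz

lemma strongCountableFanTight_iff {G : Type u} [TopologicalSpace G] [AddGroup G]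
    [IsTopologicalAddGroup G] :
    StrongCountableFanTight G ↔ S1 (blades (0 : G)) (blades (0 : G)) := by
  refine ⟨fun h => h 0, fun h y => s1_blades_of_translate y (fun A hA => ?_) h⟩
  rw [blades, mem_ofPred_eq, ← Homeomorph.image_closure]
  exact ⟨y, hA, by simp⟩

lemma strongCountableDenseFanTight_iff {G : Type u} [TopologicalSpace G] [AddGroup G]
    [IsTopologicalAddGroup G] :
    StrongCountableDenseFanTight G ↔ S1 (denseSets G) (blades (0 : G)) := by
  refine ⟨fun h => h 0, fun h y => s1_blades_of_translate y (fun A hA => ?_) h⟩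
  exact (Homeomorph.addRight (-y)).surjective.denseRange.dense_image
    (Homeomorph.addRight (-y)).continuous hA

end Point

end SelectionGame

/-- `C(X, ℝ)` carries the compact-open topology, so it is `C_k(X)`. -/
theorem mainTheorem1 (X : Type*) [TopologicalSpace X] [T35Space X] [Nonempty X] :
    List.TFAE [
      -- the `k`-variant of the compact-open game
      SelectionGame.TwoWins (SelectionGame.compactNhds X) (SelectionGame.kCovers X)ᶜ,
      SelectionGame.TwoWinsMarkov (SelectionGame.compactNhds X) (SelectionGame.kCovers X)ᶜ,
      -- the `k`-variant of the Rothberger game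
      SelectionGame.OneWins (SelectionGame.kCovers X) (SelectionGame.kCovers X),
      ¬ SelectionGame.S1 (SelectionGame.kCovers X) (SelectionGame.kCovers X),
      SelectionGame.OneWinsPre (SelectionGame.kCovers X) (SelectionGame.kCovers X),
      -- the countable fan tightness game
      SelectionGame.OneWins (SelectionGame.blades (0 : C(X, ℝ)))
        (SelectionGame.blades (0 : C(X, ℝ))),
      ¬ SelectionGame.StrongCountableFanTight C(X, ℝ),
      SelectionGame.OneWinsPre (SelectionGame.blades (0 : C(X, ℝ)))
        (SelectionGame.blades (0 : C(X, ℝ))),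
      -- the countable dense fan tightness game
      SelectionGame.OneWins (SelectionGame.denseSets C(X, ℝ))
        (SelectionGame.blades (0 : C(X, ℝ))),
      ¬ SelectionGame.StrongCountableDenseFanTight C(X, ℝ),
      SelectionGame.OneWinsPre (SelectionGame.denseSets C(X, ℝ))
        (SelectionGame.blades (0 : C(X, ℝ))),
      -- Gruenhage's clustering game
      SelectionGame.TwoWins (SelectionGame.openNhds (0 : C(X, ℝ)))
        (SelectionGame.blades (0 : C(X, ℝ)))ᶜ,
      SelectionGame.TwoWinsMarkov (SelectionGame.openNhds (0 : C(X, ℝ)))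
        (SelectionGame.blades (0 : C(X, ℝ)))ᶜ,
      -- the closure game
      SelectionGame.TwoWins (SelectionGame.nonemptyOpens C(X, ℝ))
        (SelectionGame.blades (0 : C(X, ℝ)))ᶜ,
      SelectionGame.TwoWinsMarkov (SelectionGame.nonemptyOpens C(X, ℝ))
        (SelectionGame.blades (0 : C(X, ℝ)))ᶜ,
      -- the closed discrete selection game
      SelectionGame.TwoWins (SelectionGame.nonemptyOpens C(X, ℝ))
        (SelectionGame.closedDiscrete C(X, ℝ)),
      SelectionGame.TwoWinsMarkov (SelectionGame.nonemptyOpens C(X, ℝ))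
        (SelectionGame.closedDiscrete C(X, ℝ))] := by
  tfae_have 5 → 2 := SelectionGame.OneWinsPre.twoWinsMarkov_compactNhds
  tfae_have 2 → 1 := SelectionGame.TwoWinsMarkov.twoWins
  tfae_have 1 → 3 := SelectionGame.TwoWins.oneWins_kCovers
  tfae_have 3 → 4 := SelectionGame.OneWins.not_s1_kCovers
  tfae_have 4 ↔ 5 := SelectionGame.oneWinsPre_iff_not_s1.symm
  tfae_have 5 → 17 := SelectionGame.OneWinsPre.twoWinsMarkov_closedDiscrete
  tfae_have 17 → 16 := SelectionGame.TwoWinsMarkov.twoWins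
  tfae_have 16 → 14 := SelectionGame.TwoWins.blades_of_closedDiscrete
  tfae_have 17 → 15 := SelectionGame.TwoWinsMarkov.blades_of_closedDiscrete
  tfae_have 14 → 12 := fun H =>
    H.of_shrink (inclusion SelectionGame.openNhds_subset_nonemptyOpens)
      (fun _ => Subset.rfl) fun _ _ _ h => h
  tfae_have 15 → 13 := fun H =>
    H.of_shrink (inclusion SelectionGame.openNhds_subset_nonemptyOpens)
      (fun _ => Subset.rfl) fun _ _ _ h => h
  tfae_have 13 → 12 := SelectionGame.TwoWinsMarkov.twoWins
  tfae_have 12 → 6 := fun H =>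
    have : Nonempty (SelectionGame.openNhds (0 : C(X, ℝ))) :=
      ⟨⟨univ, isOpen_univ, mem_univ _⟩⟩
    H.oneWins_dual SelectionGame.range_mem_blades_of_openNhds
  tfae_have 14 → 9 := fun H =>
    have : Nonempty (SelectionGame.nonemptyOpens C(X, ℝ)) :=
      ⟨⟨univ, isOpen_univ, univ_nonempty⟩⟩
    H.oneWins_dual SelectionGame.range_mem_denseSets
  tfae_have 15 → 11 := fun H => H.oneWinsPre_dual SelectionGame.range_mem_denseSets
  tfae_have 11 → 8 := SelectionGame.OneWinsPre.mono_left SelectionGame.denseSets_subset_blades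
  tfae_have 8 → 6 := SelectionGame.OneWinsPre.oneWins
  tfae_have 9 → 6 := SelectionGame.OneWins.mono_left SelectionGame.denseSets_subset_blades
  tfae_have 7 ↔ 8 := by
    rw [SelectionGame.strongCountableFanTight_iff, SelectionGame.oneWinsPre_iff_not_s1]
  tfae_have 10 ↔ 11 := by
    rw [SelectionGame.strongCountableDenseFanTight_iff, SelectionGame.oneWinsPre_iff_not_s1]
  tfae_have 6 → 4 := SelectionGame.OneWins.not_s1_kCovers_of_blades
  tfae_finish
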